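/- Let $1/2<\alpha<1$, let $\zeta$ be the Riemann zeta function, and for $m,l\in\mathbb N_0=\{0,1,2,\dots\}$ put $$p_\alpha(m,l)=\begin{cases}\dfrac{1}{2\zeta(2\alpha)}\left(\dfrac1{|m-l|^{2\alpha}}+\dfrac1{(m+l)^{2\alpha}}\right), & l\neq 0,\ l\neq m,\\[2ex] \dfrac{1}{2\zeta(2\alpha)}\,\dfrac1{(2m)^{2\alpha}}, & l=m\neq 0,\\[2ex] \dfrac{1}{2\zeta(2\alpha)}\,\dfrac1{m^{2\alpha}}, & l=0,\ m\neq 0,\\[1ex] 0, & l=m=0.\end{cases}$$ From every starting state in $\mathbb N_0$ there exists a Markov chain with transition probabilities $\mathbb P(X^\alpha_{n+1}=l\mid X^\alpha_n=m)=p_\alpha(m,l)$, and every Markov chain $(X^\alpha_n)_{n\ge0}$ on $\mathbb N_0$ with these transition probabilities, with an arbitrary initial distribution, is transient. That is, for every $m$ with $\mathbb P(X_0^\alpha=m)>0$, $$\mathbb P\big(X_n^\alpha=m\text{ for some }n\ge1\,\big|\,X_0^\alpha=m\big)<1,$$ and, $\mathbb P$-almost surely, $\lim_{n\to\infty}X_n^\alpha=\infty$.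 -/

import Mathlib

open MeasureTheory ProbabilityTheory Filter

/-- The transition probability `ℙ (X_{n+1} = l | X_n = m)` of the walk with parameter `α`. -/
noncomputable def transitionProb (α : ℝ) (m l : ℕ) : ℝ :=
  if l = 0 then
    if m = 0 then 0
    else 1 / (2 * (riemannZeta ((2 * α : ℝ) : ℂ)).re) * (1 / (m : ℝ) ^ (2 * α))
  else if l = m then
    1 / (2 * (riemannZeta ((2 * α : ℝ) : ℂ)).re) * (1 / (2 * (m : ℝ)) ^ (2 * α))
  else
    1 / (2 * (riemannZeta ((2 * α : ℝ) : ℂ)).re) *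
      (1 / |(m : ℝ) - (l : ℝ)| ^ (2 * α) + 1 / ((m : ℝ) + (l : ℝ)) ^ (2 * α))

/-- `X` is, under `μ`, a time-homogeneous Markov chain on `ℕ` with transition probabilities `p`
(and arbitrary initial law): conditionally on any history `X_0 = x_0, …, X_n = x_n` of positive
probability, `X_{n+1} = l` has probability `p x_n l`. -/
structure IsMarkovChainWith (p : ℕ → ℕ → ℝ) {Ω : Type*} [MeasurableSpace Ω] (μ : Measure Ω)
    (X : ℕ → Ω → ℕ) : Prop where
  measurable : ∀ n, Measurable (X n)
  cond_eq : ∀ (n : ℕ) (x : ℕ → ℕ) (l : ℕ), μ {ω | ∀ k ≤ n, X k ω = x k} ≠ 0 →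
    μ[{ω | X (n + 1) ω = l} | {ω | ∀ k ≤ n, X k ω = x k}] = ENNReal.ofReal (p (x n) l)

open scoped ENNReal

/-! The chain is |S_n| for the symmetric walk S on ℤ with step law proportional to |k|^(-2α). Hence
l ↦ cos (lθ) is an eigenfunction of the transition operator, with eigenvalue φ(θ) = `stepCharFun α
θ` (`hasSum_transitionProb_mul_cos`), and the n-step probabilities from x are cosine coefficients of
φ(θ)^n cos (xθ) (`nStepProb_eq`). Summing over n, the Green function G is at most (2/π) ∫ dθ / (1 -
|φ(θ)|) over (0, π]. The heavy tail gives 1 - |φ(θ)| ≥ c θ^(2α-1) (`le_one_sub_abs_stepCharFun`),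
and θ^(1-2α) is integrable at 0 because α < 1, so G is bounded (`exists_greenFun_le`).

Borel–Cantelli then yields escape to infinity (`tendsto_atTop`), and the superharmonic function G(·,
m) / G(m, m) bounds the return probability by 1 - 1 / G(m, m) (`cond_return_lt_one`). Existence is
the Ionescu-Tulcea construction. -/

/-- The normalizing constant `1 / (2 ζ(2α))`. -/
noncomputable def stepConst (α : ℝ) : ℝ := 1 / (2 * (riemannZeta ((2 * α : ℝ) : ℂ)).re)

/-- The step distribution of the walk on `ℤ` whose reflection is the walk of `transitionProb`. -/
noncomputable def stepProb (α : ℝ) (k : ℤ) : ℝ := stepConst α * (1 / |(k : ℝ)| ^ (2 * α))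

/-- The characteristic function of the step distribution. -/
noncomputable def stepCharFun (α : ℝ) (θ : ℝ) : ℝ := ∑' k : ℤ, stepProb α k * Real.cos (k * θ)

/-! ### The step law on ℤ and its reflection onto ℕ. -/

lemma hasSum_re_riemannZeta {s : ℝ} (hs : 1 < s) :
    HasSum (fun n : ℕ => 1 / (n : ℝ) ^ s) (riemannZeta (s : ℂ)).re := by
  have h1 : riemannZeta (s : ℂ) = ((∑' n : ℕ, 1 / (n : ℝ) ^ s : ℝ) : ℂ) := by
    rw [zeta_eq_tsum_one_div_nat_cpow (by simpa using hs), Complex.ofReal_tsum]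
    refine tsum_congr fun n => ?_
    rw [Complex.ofReal_div, Complex.ofReal_one, Complex.ofReal_cpow (Nat.cast_nonneg n)]
    simp
  rw [h1, Complex.ofReal_re]
  exact (Real.summable_one_div_nat_rpow.2 hs).hasSum

lemma re_riemannZeta_pos {s : ℝ} (hs : 1 < s) : 0 < (riemannZeta (s : ℂ)).re := by
  have h := le_hasSum (hasSum_re_riemannZeta hs) 1 fun n _ => by positivity
  simp at h
  linarith

lemma stepConst_pos {α : ℝ} (hα : 1 / 2 < α) : 0 < stepConst α := by
  have := re_riemannZeta_pos (s := 2 * α) (by linarith)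
  unfold stepConst
  positivity

lemma stepProb_nonneg {α : ℝ} (hα : 1 / 2 < α) (k : ℤ) : 0 ≤ stepProb α k := by
  have := stepConst_pos hα
  unfold stepProb
  positivity

lemma stepProb_neg (α : ℝ) (k : ℤ) : stepProb α (-k) = stepProb α k := by
  simp [stepProb]

lemma stepProb_zero {α : ℝ} (hα : 1 / 2 < α) : stepProb α 0 = 0 := by
  have : 2 * α ≠ 0 := by linarith
  simp [stepProb, Real.zero_rpow this]

lemma hasSum_stepProb {α : ℝ} (hα : 1 / 2 < α) : HasSum (stepProb α) 1 := by
  have hz := re_riemannZeta_pos (s := 2 * α) (by linarith)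
  have h0 : (2 * α) ≠ 0 := by linarith
  have h := (hasSum_re_riemannZeta (s := 2 * α) (by linarith)).mul_left (stepConst α)
  have h1 : HasSum (fun n : ℕ => stepProb α n) (stepConst α * (riemannZeta (2 * α : ℝ)).re) := by
    simpa [stepProb] using h
  have h2 : HasSum (fun n : ℕ => stepProb α (-(n + 1)))
      (stepConst α * (riemannZeta (2 * α : ℝ)).re) := by
    have h3 := (hasSum_nat_add_iff' (f := fun n : ℕ => stepProb α n) 1).2 h1
    simp only [Finset.range_one, Finset.sum_singleton, Nat.cast_zero, stepProb_zero hα,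
      sub_zero] at h3
    refine h3.congr_fun fun n => ?_
    rw [stepProb_neg]
    push_cast
    rfl
  convert h1.of_nat_of_neg_add_one h2 using 1
  unfold stepConst
  field_simp
  norm_num

/-- Reflection: l ≠ 0 is reached through l and -l, while 0 has one preimage. The case l = m fits
because `stepProb α 0 = 0`, by the convention 1 / 0 = 0. -/
lemma transitionProb_eq {α : ℝ} (hα : 1 / 2 < α) (m l : ℕ) :
    transitionProb α m l =
      stepProb α (l - m) + if l = 0 then 0 else stepProb α (-l - m) := by
  have h0 : 2 * α ≠ 0 := by linarith
  unfold transitionProb stepProb stepConst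
  have e : |-(l : ℝ) - m| = (m : ℝ) + l := by
    rw [show -(l : ℝ) - m = -(m + l) by ring, abs_neg, abs_of_nonneg (by positivity)]
  push_cast
  rw [e]
  split_ifs with h1 h2 h2
  · subst h1 h2; simp [Real.zero_rpow h0]
  · subst h1; simp
  · subst h2; simp [Real.zero_rpow h0, ← two_mul]
  · rw [abs_sub_comm]; ring

lemma transitionProb_nonneg {α : ℝ} (hα : 1 / 2 < α) (m l : ℕ) : 0 ≤ transitionProb α m l := by
  rw [transitionProb_eq hα]
  have := stepProb_nonneg hα
  split_ifs
  · simpa using this _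
  · exact add_nonneg (this _) (this _)

/-- Folding a sum over `ℤ` against an even function onto `ℕ`. -/
lemma hasSum_transitionProb_mul {α : ℝ} (hα : 1 / 2 < α) (m : ℕ) {f : ℤ → ℝ}
    (hf : ∀ k, f (-k) = f k) {S : ℝ} (h : HasSum (fun k : ℤ => stepProb α k * f (k + m)) S) :
    HasSum (fun l : ℕ => transitionProb α m l * f l) S := by
  have h1 : HasSum (fun k : ℤ => stepProb α (k - m) * f k) S := by
    rw [← (Equiv.addRight (m : ℤ)).hasSum_iff]
    simpa [Function.comp_def] using h
  have h2 := h1.nat_add_neg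
  -- Pairing k with -k counts k = 0 twice; one copy is removed.
  have h3 : HasSum (fun l : ℕ => if l = 0 then stepProb α (0 - m) * f 0 else 0)
      (stepProb α (0 - m) * f 0) := hasSum_ite_eq 0 _
  have h4 := h2.sub h3
  rw [add_sub_cancel_right] at h4
  refine h4.congr_fun fun l => ?_
  rw [transitionProb_eq hα, hf]
  split_ifs with hl
  · subst hl; simp
  · ring

lemma hasSum_transitionProb {α : ℝ} (hα : 1 / 2 < α) (m : ℕ) :
    HasSum (transitionProb α m) 1 := by
  simpa using hasSum_transitionProb_mul hα m (f := fun _ => 1) (fun _ => rfl)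
    (by simpa using hasSum_stepProb hα)

lemma summable_stepProb_mul {α : ℝ} (hα : 1 / 2 < α) {f : ℤ → ℝ} (hf : ∀ k, |f k| ≤ 1) :
    Summable fun k : ℤ => stepProb α k * f k := by
  refine (hasSum_stepProb hα).summable.of_norm_bounded fun k => ?_
  rw [norm_mul, Real.norm_of_nonneg (stepProb_nonneg hα k)]
  exact mul_le_of_le_one_right (stepProb_nonneg hα k) (hf k)

lemma hasSum_stepCharFun {α : ℝ} (hα : 1 / 2 < α) (θ : ℝ) :
    HasSum (fun k : ℤ => stepProb α k * Real.cos (k * θ)) (stepCharFun α θ) :=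
  (summable_stepProb_mul hα fun _ => Real.abs_cos_le_one _).hasSum

lemma continuous_stepCharFun {α : ℝ} (hα : 1 / 2 < α) : Continuous (stepCharFun α) := by
  refine continuous_tsum (fun k => by fun_prop) (hasSum_stepProb hα).summable fun k θ => ?_
  rw [norm_mul, Real.norm_of_nonneg (stepProb_nonneg hα k)]
  exact mul_le_of_le_one_right (stepProb_nonneg hα k) (Real.abs_cos_le_one _)

/-- The functions `l ↦ cos (l θ)` are eigenfunctions of the transition operator. -/
lemma hasSum_transitionProb_mul_cos {α : ℝ} (hα : 1 / 2 < α) (m : ℕ) (θ : ℝ) :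
    HasSum (fun l : ℕ => transitionProb α m l * Real.cos (l * θ))
      (stepCharFun α θ * Real.cos (m * θ)) := by
  have key : HasSum (fun k : ℤ => stepProb α k * Real.cos (((k + m : ℤ) : ℝ) * θ))
      (stepCharFun α θ * Real.cos (m * θ)) := by
    -- The sine part vanishes since the step law is even.
    have hs : HasSum (fun k : ℤ => stepProb α k * Real.sin (k * θ)) 0 := by
      have h1 : Summable fun k : ℤ => stepProb α k * Real.sin (k * θ) :=
        summable_stepProb_mul hα fun _ => Real.abs_sin_le_one _
      have h2 := h1.hasSum
      have h3 : HasSum (fun k : ℤ => stepProb α k * Real.sin (k * θ))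
          (-∑' k : ℤ, stepProb α k * Real.sin (k * θ)) := by
        rw [← (Equiv.neg ℤ).hasSum_iff]
        refine h2.neg.congr_fun fun k => ?_
        simp [stepProb_neg]
      have := h2.unique h3
      rwa [show ∑' k : ℤ, stepProb α k * Real.sin (k * θ) = 0 by linarith] at h2
    have := ((hasSum_stepCharFun hα θ).mul_right (Real.cos (m * θ))).sub
      (hs.mul_right (Real.sin (m * θ)))
    rw [zero_mul, sub_zero] at this
    refine this.congr_fun fun k => ?_
    push_cast
    rw [add_mul, Real.cos_add]
    ring
  simpa using hasSum_transitionProb_mul hα m (f := fun k : ℤ => Real.cos (k * θ))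
    (fun k => by simp) key

/-! ### Bounds keeping the characteristic function away from ±1. -/

lemma sum_Icc_le_of_hasSum_int {f : ℤ → ℝ} (hf : ∀ k, 0 ≤ f k) {S : ℝ} (h : HasSum f S) (N : ℕ) :
    ∑ k ∈ Finset.Icc 1 N, f (k : ℤ) ≤ S := by
  have := sum_le_hasSum ((Finset.Icc 1 N).map Nat.castEmbedding) (fun k _ => hf k) h
  simpa using this

/-- Only the terms 1 ≤ k ≤ π/θ are kept: there 1 - cos (kθ) ≥ 2(kθ/π)² and k^(1-2α) ≥ (θ/π)^(2α-1),
which leaves a multiple of ∑ k. -/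
lemma le_one_sub_stepCharFun {α : ℝ} (hα : 1 / 2 < α) {θ : ℝ} (h0 : 0 < θ)
    (hπ : θ ≤ Real.pi) :
    stepConst α / 2 * (θ / Real.pi) ^ (2 * α - 1) ≤ 1 - stepCharFun α θ := by
  have hC := stepConst_pos hα
  have hpi := Real.pi_pos
  have hsum : HasSum (fun k : ℤ => stepProb α k * (1 - Real.cos (k * θ)))
      (1 - stepCharFun α θ) :=
    ((hasSum_stepProb hα).sub (hasSum_stepCharFun hα θ)).congr_fun fun k => by ring
  set N := ⌊Real.pi / θ⌋₊ with hN
  have hN1 : 1 ≤ N := Nat.le_floor (by rw [Nat.cast_one, le_div_iff₀ h0]; linarith)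
  have hNle : (N : ℝ) ≤ Real.pi / θ := Nat.floor_le (by positivity)
  have hNlt : Real.pi / θ < N + 1 := Nat.lt_floor_add_one _
  set r := (θ / Real.pi) ^ (2 * α - 1) with hr
  have hr0 : 0 < r := by positivity
  refine le_trans ?_ (sum_Icc_le_of_hasSum_int
    (fun k => mul_nonneg (stepProb_nonneg hα k) (by linarith [Real.cos_le_one (k * θ)])) hsum N)
  have hterm : ∀ k ∈ Finset.Icc 1 N, (2 * stepConst α * θ ^ 2 / Real.pi ^ 2 * r) * (k : ℝ) ≤
      stepProb α k * (1 - Real.cos (((k : ℕ) : ℤ) * θ)) := by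
    intro k hk
    obtain ⟨hk1, hkN⟩ := Finset.mem_Icc.1 hk
    have hk0 : (0 : ℝ) < k := by exact_mod_cast hk1
    have hkle : (k : ℝ) ≤ Real.pi / θ := le_trans (by exact_mod_cast hkN) hNle
    have hkθ : (k : ℝ) * θ ≤ Real.pi := by rwa [le_div_iff₀ h0] at hkle
    have hcos : 2 / Real.pi ^ 2 * (k * θ) ^ 2 ≤ 1 - Real.cos (k * θ) := by
      have := Real.cos_le_one_sub_mul_cos_sq (x := k * θ)
        (by rw [abs_of_nonneg (by positivity)]; exact hkθ)
      linarith
    have hpow : r ≤ k * (1 / (k : ℝ) ^ (2 * α)) := by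
      have e : (k : ℝ) ^ (2 * α) = k * (k : ℝ) ^ (2 * α - 1) := by
        rw [Real.rpow_sub_one hk0.ne']; field_simp
      have e2 : (k : ℝ) * (1 / (k : ℝ) ^ (2 * α)) = (1 / (k : ℝ)) ^ (2 * α - 1) := by
        rw [e, Real.div_rpow zero_le_one hk0.le, Real.one_rpow]
        field_simp
      rw [e2]
      refine Real.rpow_le_rpow (by positivity) ?_ (by linarith)
      rw [div_le_div_iff₀ hpi hk0]
      linarith
    unfold stepProb
    push_cast
    rw [abs_of_pos hk0]
    calc 2 * stepConst α * θ ^ 2 / Real.pi ^ 2 * r * k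
        ≤ 2 * stepConst α * θ ^ 2 / Real.pi ^ 2 * (k * (1 / (k : ℝ) ^ (2 * α))) * k := by gcongr
      _ = stepConst α * (1 / (k : ℝ) ^ (2 * α)) * (2 / Real.pi ^ 2 * (k * θ) ^ 2) := by
          field_simp
      _ ≤ _ := by gcongr
  refine le_trans ?_ (Finset.sum_le_sum hterm)
  rw [← Finset.mul_sum]
  have hg : ∑ k ∈ Finset.Icc 1 N, (k : ℝ) = N * (N + 1) / 2 := by
    have := Finset.sum_range_id_mul_two (N + 1)
    have h2 : ∑ k ∈ Finset.Icc 1 N, k = ∑ k ∈ Finset.range (N + 1), k := by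
      rw [Finset.range_eq_Ico, Finset.sum_eq_sum_Ico_succ_bot (by lia)]
      rw [zero_add, zero_add]
      rfl
    rw [← h2] at this
    have h3 : ((∑ k ∈ Finset.Icc 1 N, k : ℕ) : ℝ) * 2 = (N + 1) * N := by exact_mod_cast this
    push_cast at h3
    linarith
  rw [hg]
  have hN1' : (1 : ℝ) ≤ N := by exact_mod_cast hN1
  have hA : Real.pi < (N + 1) * θ := by rwa [div_lt_iff₀ h0] at hNlt
  -- Uses N ≥ (N + 1)/2, valid as N ≥ 1.
  have hB : Real.pi ^ 2 / 2 ≤ θ ^ 2 * (N * (N + 1)) := by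
    have h1 : Real.pi ^ 2 ≤ ((N + 1) * θ) ^ 2 := by gcongr
    nlinarith [mul_nonneg (sq_nonneg θ) (mul_nonneg (sub_nonneg.2 hN1') (by positivity : (0 : ℝ) ≤ N + 1))]
  calc stepConst α / 2 * r
      = 2 * stepConst α / Real.pi ^ 2 * r * (Real.pi ^ 2 / 2) / 2 := by field_simp
    _ ≤ 2 * stepConst α / Real.pi ^ 2 * r * (θ ^ 2 * (N * (N + 1))) / 2 := by gcongr
    _ = _ := by ring

/-- The steps k = 1, 2 suffice: 1 + cos θ and 1 + cos 2θ never vanish together. -/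
lemma le_one_add_stepCharFun {α : ℝ} (hα : 1 / 2 < α) (hα' : α < 1) (θ : ℝ) :
    stepConst α / 8 ≤ 1 + stepCharFun α θ := by
  have hC := stepConst_pos hα
  have hsum : HasSum (fun k : ℤ => stepProb α k * (1 + Real.cos (k * θ)))
      (1 + stepCharFun α θ) :=
    ((hasSum_stepProb hα).add (hasSum_stepCharFun hα θ)).congr_fun fun k => by ring
  refine le_trans ?_ (sum_Icc_le_of_hasSum_int
    (fun k => mul_nonneg (stepProb_nonneg hα k) (by linarith [Real.neg_one_le_cos (k * θ)])) hsum 2)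
  have hI : Finset.Icc 1 2 = {1, 2} := rfl
  rw [hI, Finset.sum_pair (by norm_num)]
  have h1 : stepProb α ((1 : ℕ) : ℤ) = stepConst α := by simp [stepProb]
  have h2 : stepConst α / 4 ≤ stepProb α ((2 : ℕ) : ℤ) := by
    have : (2 : ℝ) ^ (2 * α) ≤ 4 := by
      calc (2 : ℝ) ^ (2 * α) ≤ (2 : ℝ) ^ (2 : ℝ) :=
            Real.rpow_le_rpow_of_exponent_le (by norm_num) (by linarith)
        _ = 4 := by norm_num
    simp only [stepProb, div_eq_mul_inv]
    norm_num
    gcongr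
    rw [one_div]
    exact inv_anti₀ (by positivity) this
  rw [h1]
  push_cast
  rw [Real.cos_two_mul, one_mul]
  have := Real.neg_one_le_cos θ
  have h3 : stepConst α / 4 * (1 + (2 * Real.cos θ ^ 2 - 1)) ≤
      stepProb α ((2 : ℕ) : ℤ) * (1 + (2 * Real.cos θ ^ 2 - 1)) :=
    mul_le_mul_of_nonneg_right h2 (by nlinarith [sq_nonneg (Real.cos θ)])
  have h4 : 0 ≤ stepConst α * ((1 + Real.cos θ) * 3 / 4) := by
    apply mul_nonneg hC.le; linarith
  have h5 : 0 ≤ stepConst α * (2 * Real.cos θ + 1) ^ 2 := by positivity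
  push_cast at h3
  nlinarith

lemma le_one_sub_abs_stepCharFun {α : ℝ} (hα : 1 / 2 < α) (hα' : α < 1) {θ : ℝ} (h0 : 0 < θ)
    (hπ : θ ≤ Real.pi) :
    stepConst α / 8 * (θ / Real.pi) ^ (2 * α - 1) ≤ 1 - |stepCharFun α θ| := by
  have hC := stepConst_pos hα
  have h1 := le_one_sub_stepCharFun hα h0 hπ
  have h2 := le_one_add_stepCharFun hα hα' θ
  have hr0 : 0 ≤ (θ / Real.pi) ^ (2 * α - 1) := by have := Real.pi_pos; positivity
  have hr1 : (θ / Real.pi) ^ (2 * α - 1) ≤ 1 :=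
    Real.rpow_le_one (by have := Real.pi_pos; positivity)
      ((div_le_one Real.pi_pos).2 hπ) (by linarith)
  rcases abs_cases (stepCharFun α θ) with ⟨h, _⟩ | ⟨h, _⟩ <;> rw [h]
  · nlinarith
  · nlinarith

/-! ### Fourier representation of n-step probabilities and the Green function bound. -/

/-- The `n`-step transition probabilities of the transition matrix `p`. -/
noncomputable def nStepProb (p : ℕ → ℕ → ℝ) : ℕ → ℕ → ℕ → ℝ≥0∞
  | 0, x, y => if x = y then 1 else 0
  | n + 1, x, y => ∑' l, ENNReal.ofReal (p x l) * nStepProb p n l y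

/-- The Green function of the transition matrix `p`. -/
noncomputable def greenFun (p : ℕ → ℕ → ℝ) (x y : ℕ) : ℝ≥0∞ := ∑' n, nStepProb p n x y

/-- The cosine transform of the `n`-th power of the characteristic function. -/
noncomputable def cosTransform (α : ℝ) (n x y : ℕ) : ℝ :=
  ∫ θ in (0 : ℝ)..Real.pi, stepCharFun α θ ^ n * Real.cos (x * θ) * Real.cos (y * θ)

lemma abs_stepCharFun_le_one {α : ℝ} (hα : 1 / 2 < α) (θ : ℝ) : |stepCharFun α θ| ≤ 1 := by
  refine (hasSum_stepCharFun hα θ).norm_le_of_bounded (hasSum_stepProb hα) fun k => ?_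
  rw [norm_mul, Real.norm_of_nonneg (stepProb_nonneg hα k)]
  exact mul_le_of_le_one_right (stepProb_nonneg hα k) (Real.abs_cos_le_one _)

/-- The eigenfunction relation integrated against φ^n cos (yθ); the transition probabilities
themselves dominate the series. -/
lemma hasSum_transitionProb_mul_cosTransform {α : ℝ} (hα : 1 / 2 < α) (n x y : ℕ) :
    HasSum (fun l => transitionProb α x l * cosTransform α n l y) (cosTransform α (n + 1) x y) := by
  have hc := continuous_stepCharFun hα
  simp only [cosTransform, ← intervalIntegral.integral_const_mul]
  refine intervalIntegral.hasSum_integral_of_dominated_convergence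
    (fun l _ => transitionProb α x l) (fun l => ?_) (fun l => ?_) ?_ ?_ ?_
  · exact Continuous.aestronglyMeasurable (by fun_prop)
  · refine ae_of_all _ fun θ _ => ?_
    rw [norm_mul, Real.norm_of_nonneg (transitionProb_nonneg hα x l), Real.norm_eq_abs, abs_mul,
      abs_mul, abs_pow]
    refine mul_le_of_le_one_right (transitionProb_nonneg hα x l) ?_
    exact mul_le_one₀ (mul_le_one₀ (pow_le_one₀ (abs_nonneg _) (abs_stepCharFun_le_one hα θ))
      (abs_nonneg _) (Real.abs_cos_le_one _)) (abs_nonneg _) (Real.abs_cos_le_one _)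
  · exact ae_of_all _ fun θ _ => (hasSum_transitionProb hα x).summable
  · exact intervalIntegrable_const
  · refine ae_of_all _ fun θ _ => ?_
    have := ((hasSum_transitionProb_mul_cos hα x θ).mul_left
      (stepCharFun α θ ^ n)).mul_right (Real.cos (y * θ))
    rw [← mul_assoc, ← pow_succ] at this
    exact this.congr_fun fun l => by ring

lemma integral_cos_int_mul (k : ℤ) :
    ∫ θ in (0 : ℝ)..Real.pi, Real.cos (k * θ) = if k = 0 then Real.pi else 0 := by
  split_ifs with hk
  · simp [hk]
  · have : (k : ℝ) ≠ 0 := by exact_mod_cast hk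
    rw [intervalIntegral.integral_comp_mul_left _ this]
    simp [Real.sin_int_mul_pi]

lemma cosTransform_zero (α : ℝ) (x y : ℕ) :
    (if y = 0 then 1 / Real.pi else 2 / Real.pi) * cosTransform α 0 x y = if x = y then 1 else 0 := by
  have hπ := Real.pi_pos
  have h : cosTransform α 0 x y =
      ((if (x : ℤ) - y = 0 then Real.pi else 0) + if (x : ℤ) + y = 0 then Real.pi else 0) / 2 := by
    rw [← integral_cos_int_mul, ← integral_cos_int_mul, ← intervalIntegral.integral_add
      (Continuous.intervalIntegrable (by fun_prop) _ _)
      (Continuous.intervalIntegrable (by fun_prop) _ _), ← intervalIntegral.integral_div]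
    refine intervalIntegral.integral_congr fun θ _ => ?_
    simp only [pow_zero, one_mul]
    push_cast
    rw [sub_mul, add_mul, Real.cos_sub, Real.cos_add]
    ring
  rw [h]
  by_cases hy : y = 0
  · subst hy
    by_cases hx : x = 0
    · simp [hx]
    · simp [hx]
  · have h2 : (x : ℤ) + y ≠ 0 := by lia
    by_cases hx : x = y
    · subst hx
      simp only [sub_self, if_true, if_neg h2, if_neg hy]
      field_simp
      norm_num
    · have h3 : (x : ℤ) - y ≠ 0 := by lia
      simp [h2, h3, hx]

/-- Both sides satisfy the same recursion. Nonnegativity is part of the induction because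
`ENNReal.ofReal` truncates negative values. -/
lemma nStepProb_eq {α : ℝ} (hα : 1 / 2 < α) (n x y : ℕ) :
    0 ≤ (if y = 0 then 1 / Real.pi else 2 / Real.pi) * cosTransform α n x y ∧
    nStepProb (transitionProb α) n x y =
      ENNReal.ofReal ((if y = 0 then 1 / Real.pi else 2 / Real.pi) * cosTransform α n x y) := by
  induction n generalizing x with
  | zero =>
    rw [cosTransform_zero, nStepProb]
    split_ifs <;> simp
  | succ n ih =>
    set w : ℝ := if y = 0 then 1 / Real.pi else 2 / Real.pi with hw
    have h := (hasSum_transitionProb_mul_cosTransform hα n x y).mul_left w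
    have h0 : ∀ l, 0 ≤ w * (transitionProb α x l * cosTransform α n l y) := fun l => by
      rw [mul_left_comm]
      exact mul_nonneg (transitionProb_nonneg hα x l) (ih l).1
    refine ⟨h.nonneg h0, ?_⟩
    rw [← h.tsum_eq, ENNReal.ofReal_tsum_of_nonneg h0 h.summable, nStepProb]
    refine tsum_congr fun l => ?_
    rw [(ih l).2, ← ENNReal.ofReal_mul (transitionProb_nonneg hα x l), mul_left_comm]

lemma nStepProb_le_lintegral {α : ℝ} (hα : 1 / 2 < α) (n x y : ℕ) :
    nStepProb (transitionProb α) n x y ≤ ENNReal.ofReal (2 / Real.pi) *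
      ∫⁻ θ in Set.Ioc 0 Real.pi, ENNReal.ofReal |stepCharFun α θ| ^ n := by
  have hπ := Real.pi_pos
  have hc := continuous_stepCharFun hα
  have h1 : |cosTransform α n x y| ≤ ∫ θ in Set.Ioc 0 Real.pi, |stepCharFun α θ| ^ n := by
    rw [← intervalIntegral.integral_of_le hπ.le]
    refine (intervalIntegral.abs_integral_le_integral_abs hπ.le).trans ?_
    refine intervalIntegral.integral_mono_on hπ.le
      (Continuous.intervalIntegrable (by fun_prop) _ _)
      (Continuous.intervalIntegrable (by fun_prop) _ _) fun θ _ => ?_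
    rw [abs_mul, abs_mul, abs_pow, mul_assoc]
    exact mul_le_of_le_one_right (by positivity)
      (mul_le_one₀ (Real.abs_cos_le_one _) (abs_nonneg _) (Real.abs_cos_le_one _))
  have hint : IntegrableOn (fun θ => |stepCharFun α θ| ^ n) (Set.Ioc 0 Real.pi) :=
    ((by fun_prop : Continuous fun θ => |stepCharFun α θ| ^ n).intervalIntegrable 0 Real.pi).1
  simp_rw [← ENNReal.ofReal_pow (abs_nonneg _)]
  rw [(nStepProb_eq hα n x y).2, ← ofReal_integral_eq_lintegral_ofReal hint
    (ae_of_all _ fun θ => by positivity), ← ENNReal.ofReal_mul (by positivity)]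
  refine ENNReal.ofReal_le_ofReal ?_
  calc _ ≤ (if y = 0 then 1 / Real.pi else 2 / Real.pi) * |cosTransform α n x y| := by
        refine mul_le_mul_of_nonneg_left (le_abs_self _) ?_
        split_ifs <;> positivity
    _ ≤ 2 / Real.pi * |cosTransform α n x y| := by
        gcongr
        split_ifs
        · gcongr; norm_num
        · exact le_rfl
    _ ≤ _ := by gcongr

/-- The Green function of the walk is uniformly bounded. -/
lemma exists_greenFun_le {α : ℝ} (hα : 1 / 2 < α) (hα' : α < 1) :
    ∃ K : ℝ≥0∞, K ≠ ∞ ∧ ∀ x y, greenFun (transitionProb α) x y ≤ K := by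
  have hπ := Real.pi_pos
  have hc := continuous_stepCharFun hα
  have hC := stepConst_pos hα
  refine ⟨ENNReal.ofReal (2 / Real.pi) *
    ∫⁻ θ in Set.Ioc 0 Real.pi, (1 - ENNReal.ofReal |stepCharFun α θ|)⁻¹, ?_, fun x y => ?_⟩
  · refine ENNReal.mul_ne_top ENNReal.ofReal_ne_top ?_
    -- The exponent 1 - 2α exceeds -1 exactly because α < 1.
    have hint : IntegrableOn (fun θ : ℝ => (stepConst α / 8)⁻¹ * Real.pi ^ (2 * α - 1) *
        θ ^ (1 - 2 * α)) (Set.Ioc 0 Real.pi) :=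
      ((intervalIntegral.intervalIntegrable_rpow' (by linarith)).const_mul _).1
    refine ne_top_of_le_ne_top hint.lintegral_lt_top.ne ?_
    refine setLIntegral_mono' measurableSet_Ioc fun θ hθ => ?_
    have hθ0 : 0 < θ := hθ.1
    have hb := le_one_sub_abs_stepCharFun hα hα' hθ.1 hθ.2
    have hpos : 0 < stepConst α / 8 * (θ / Real.pi) ^ (2 * α - 1) := by positivity
    rw [← ENNReal.ofReal_one, ← ENNReal.ofReal_sub _ (abs_nonneg _),
      ← ENNReal.ofReal_inv_of_pos (hpos.trans_le hb)]
    refine ENNReal.ofReal_le_ofReal ((inv_anti₀ hpos hb).trans_eq ?_)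
    rw [mul_inv, Real.div_rpow hθ0.le hπ.le, inv_div (θ ^ (2 * α - 1)), mul_assoc,
      show 1 - 2 * α = -(2 * α - 1) by ring, Real.rpow_neg hθ0.le,
      div_eq_mul_inv (Real.pi ^ (2 * α - 1))]
  · simp_rw [← ENNReal.tsum_geometric]
    rw [lintegral_tsum fun n => (by fun_prop), ← ENNReal.tsum_mul_left]
    exact ENNReal.tsum_le_tsum fun n => nStepProb_le_lintegral hα n x y

/-- First-step decomposition: G(·, y) is superharmonic, with defect 1 at y only. -/
lemma greenFun_eq (p : ℕ → ℕ → ℝ) (x y : ℕ) :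
    greenFun p x y = (if x = y then 1 else 0) + ∑' l, ENNReal.ofReal (p x l) * greenFun p l y := by
  unfold greenFun
  rw [tsum_eq_zero_add' ENNReal.summable]
  simp_rw [← ENNReal.tsum_mul_left]
  rw [ENNReal.tsum_comm]
  rfl

/-! ### From the Green function to path properties. -/

lemma history_update {Ω : Type*} (X : ℕ → Ω → ℕ) (n : ℕ) (x : ℕ → ℕ) (l : ℕ) :
    {ω | ∀ k ≤ n + 1, X k ω = Function.update x (n + 1) l k} =
      {ω | ∀ k ≤ n, X k ω = x k} ∩ {ω | X (n + 1) ω = l} := by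
  ext ω
  constructor
  · intro h
    refine ⟨fun k hk => ?_, ?_⟩
    · have := h k (by lia)
      rwa [Function.update_of_ne (by lia)] at this
    · simpa using h (n + 1) le_rfl
  · rintro ⟨h1, h2⟩ k hk
    rcases eq_or_ne k (n + 1) with rfl | hk'
    · simpa using h2
    · rw [Function.update_of_ne hk']
      exact h1 k (by lia)

namespace IsMarkovChainWith

variable {p : ℕ → ℕ → ℝ} {Ω : Type*} [MeasurableSpace Ω] {μ : Measure Ω} {X : ℕ → Ω → ℕ}

lemma measurableSet_eq (hX : IsMarkovChainWith p μ X) (n y : ℕ) :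
    MeasurableSet {ω | X n ω = y} :=
  hX.measurable n (measurableSet_singleton y)

lemma measurableSet_hit (hX : IsMarkovChainWith p μ X) (n j m : ℕ) :
    MeasurableSet {ω | ∃ i ≤ n, X (j + i) ω = m} := by
  simp only [Set.ofPred_exists, ← exists_prop]
  exact MeasurableSet.iUnion fun i => MeasurableSet.iUnion fun _ => hX.measurableSet_eq (j + i) m

lemma measurableSet_history (hX : IsMarkovChainWith p μ X) (n : ℕ) (x : ℕ → ℕ) :
    MeasurableSet {ω | ∀ k ≤ n, X k ω = x k} := by
  simp only [Set.ofPred_forall]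
  exact MeasurableSet.iInter fun k => MeasurableSet.iInter fun _ => hX.measurableSet_eq k (x k)

lemma measure_inter_eq_tsum (hX : IsMarkovChainWith p μ X) (n : ℕ) {B : Set Ω}
    (hB : MeasurableSet B) :
    μ B = ∑' l, μ ({ω | X n ω = l} ∩ B) := by
  rw [← measure_iUnion]
  · congr 1
    ext ω
    simp
  · intro a b hab
    refine Set.disjoint_left.2 fun ω h1 h2 => hab ?_
    exact h1.1.symm.trans h2.1
  · exact fun l => (hX.measurableSet_eq n l).inter hB

lemma measure_history_succ [IsFiniteMeasure μ] (hX : IsMarkovChainWith p μ X) (n : ℕ) (x : ℕ → ℕ)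
    (l : ℕ) :
    μ {ω | ∀ k ≤ n + 1, X k ω = Function.update x (n + 1) l k} =
      μ {ω | ∀ k ≤ n, X k ω = x k} * ENNReal.ofReal (p (x n) l) := by
  rw [history_update]
  by_cases h : μ {ω | ∀ k ≤ n, X k ω = x k} = 0
  · rw [h, zero_mul]
    exact measure_mono_null Set.inter_subset_left h
  · rw [← hX.cond_eq n x l h, cond_apply (hX.measurableSet_history n x), ← mul_assoc,
      ENNReal.mul_inv_cancel h (measure_ne_top _ _), one_mul]

lemma measure_history_inter_eq_tsum (hX : IsMarkovChainWith p μ X) (n : ℕ) (x : ℕ → ℕ) {B : Set Ω}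
    (hB : MeasurableSet B) :
    μ ({ω | ∀ k ≤ n, X k ω = x k} ∩ B) =
      ∑' l, μ ({ω | ∀ k ≤ n + 1, X k ω = Function.update x (n + 1) l k} ∩ B) := by
  rw [hX.measure_inter_eq_tsum (n + 1) ((hX.measurableSet_history n x).inter hB)]
  refine tsum_congr fun l => ?_
  rw [history_update, ← Set.inter_assoc, Set.inter_comm {ω | X (n + 1) ω = l}]

/-- Induction on n over all histories, each extended by one more state. -/
lemma measure_history_inter_visit [IsFiniteMeasure μ] (hX : IsMarkovChainWith p μ X) (n j : ℕ)
    (x : ℕ → ℕ) (y : ℕ) :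
    μ ({ω | ∀ k ≤ j, X k ω = x k} ∩ {ω | X (j + n) ω = y}) =
      μ {ω | ∀ k ≤ j, X k ω = x k} * nStepProb p n (x j) y := by
  induction n generalizing j x with
  | zero =>
    rw [nStepProb]
    split_ifs with h
    · rw [mul_one]
      congr 1
      exact Set.inter_eq_left.2 fun ω hω => (hω j le_rfl).trans h
    · rw [mul_zero]
      convert measure_empty (μ := μ)
      exact Set.eq_empty_of_forall_notMem fun ω hω => h ((hω.1 j le_rfl).symm.trans hω.2)
  | succ n ih =>
    rw [hX.measure_history_inter_eq_tsum j x (hX.measurableSet_eq _ _), nStepProb,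
      ← ENNReal.tsum_mul_left]
    refine tsum_congr fun l => ?_
    have := ih (j + 1) (Function.update x (j + 1) l)
    rw [hX.measure_history_succ, Function.update_self] at this
    rw [← mul_assoc, ← this, show j + 1 + n = j + (n + 1) by ring]

lemma measure_visit [IsFiniteMeasure μ] (hX : IsMarkovChainWith p μ X) (n y : ℕ) :
    μ {ω | X n ω = y} = ∑' x, μ {ω | X 0 ω = x} * nStepProb p n x y := by
  rw [hX.measure_inter_eq_tsum 0 (hX.measurableSet_eq n y)]
  refine tsum_congr fun x => ?_
  simpa using hX.measure_history_inter_visit n 0 (fun _ => x) y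

/-- A chain with a bounded Green function leaves every finite set eventually. -/
lemma tendsto_atTop [IsProbabilityMeasure μ] (hX : IsMarkovChainWith p μ X) {K : ℝ≥0∞}
    (hK : K ≠ ∞) (hG : ∀ x y, greenFun p x y ≤ K) :
    ∀ᵐ ω ∂μ, Tendsto (fun n => X n ω) atTop atTop := by
  -- The expected number of visits to y is an average of G(x, y) over the initial law.
  have h1 : ∀ y, ∑' n, μ {ω | X n ω = y} ≠ ∞ := by
    intro y
    refine ne_top_of_le_ne_top hK ?_
    rw [tsum_congr fun n => hX.measure_visit n y, ENNReal.tsum_comm]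
    calc ∑' x, ∑' n, μ {ω | X 0 ω = x} * nStepProb p n x y
        = ∑' x, μ {ω | X 0 ω = x} * ∑' n, nStepProb p n x y :=
          tsum_congr fun x => ENNReal.tsum_mul_left
      _ ≤ ∑' x, μ {ω | X 0 ω = x} * K := by
          refine ENNReal.tsum_le_tsum fun x => ?_
          gcongr
          exact hG x y
      _ = K := by
          rw [ENNReal.tsum_mul_right]
          have := hX.measure_inter_eq_tsum 0 MeasurableSet.univ
          simp only [Set.inter_univ, measure_univ] at this
          rw [← this, one_mul]
  have h2 : ∀ᵐ ω ∂μ, ∀ y, ∀ᶠ n in atTop, ω ∉ {ω | X n ω = y} :=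
    ae_all_iff.2 fun y => ae_eventually_notMem (h1 y)
  filter_upwards [h2] with ω hω
  refine Filter.tendsto_atTop.2 fun b => ?_
  have h3 : ∀ᶠ n in atTop, ∀ y ∈ Set.Iio b, ω ∉ {ω | X n ω = y} :=
    (eventually_all_finite (Set.finite_Iio b)).2 fun y _ => hω y
  filter_upwards [h3] with n hn
  by_contra hlt
  exact hn (X n ω) (not_le.1 hlt) rfl

/-- A superharmonic function which is at least `1` at `m` bounds the probability to hit `m`. -/
lemma measure_history_inter_hit_le [IsFiniteMeasure μ] (hX : IsMarkovChainWith p μ X) {m : ℕ}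
    {h : ℕ → ℝ≥0∞} (hm : 1 ≤ h m) (hh : ∀ x, ∑' l, ENNReal.ofReal (p x l) * h l ≤ h x)
    (n j : ℕ) (x : ℕ → ℕ) :
    μ ({ω | ∀ k ≤ j, X k ω = x k} ∩ {ω | ∃ i ≤ n, X (j + i) ω = m}) ≤
      μ {ω | ∀ k ≤ j, X k ω = x k} * h (x j) := by
  induction n generalizing j x with
  | zero =>
    by_cases hx : x j = m
    · rw [hx]
      exact (measure_mono Set.inter_subset_left).trans (le_mul_of_one_le_right' hm)
    · refine le_of_eq_of_le (b := 0) ?_ bot_le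
      convert measure_empty (μ := μ)
      refine Set.eq_empty_of_forall_notMem fun ω hω => hx ?_
      obtain ⟨h1, i, hi, h2⟩ := hω
      obtain rfl : i = 0 := by lia
      exact (h1 j le_rfl).symm.trans h2
  | succ n ih =>
    by_cases hx : x j = m
    · rw [hx]
      exact (measure_mono Set.inter_subset_left).trans (le_mul_of_one_le_right' hm)
    · calc _ ≤ μ ({ω | ∀ k ≤ j, X k ω = x k} ∩ {ω | ∃ i ≤ n, X (j + 1 + i) ω = m}) := by
            refine measure_mono fun ω hω => ⟨hω.1, ?_⟩
            obtain ⟨h1, i, hi, h2⟩ := hω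
            cases i with
            | zero => exact absurd ((h1 j le_rfl).symm.trans h2) hx
            | succ i => exact ⟨i, by lia, by rw [← h2, show j + 1 + i = j + (i + 1) by ring]⟩
        _ = ∑' l, μ ({ω | ∀ k ≤ j + 1, X k ω = Function.update x (j + 1) l k} ∩
              {ω | ∃ i ≤ n, X (j + 1 + i) ω = m}) :=
            hX.measure_history_inter_eq_tsum j x (hX.measurableSet_hit n (j + 1) m)
        _ ≤ ∑' l, μ {ω | ∀ k ≤ j, X k ω = x k} * (ENNReal.ofReal (p (x j) l) * h l) := by
            refine ENNReal.tsum_le_tsum fun l => (ih _ _).trans_eq ?_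
            rw [hX.measure_history_succ, Function.update_self, mul_assoc]
        _ ≤ _ := by
            rw [ENNReal.tsum_mul_left]
            gcongr
            exact hh _

/-- A return is a hit after one step, so the bound is the one-step average of h from m, which can be
below 1 even when h m = 1. -/
lemma measure_return_le [IsFiniteMeasure μ] (hX : IsMarkovChainWith p μ X) {m : ℕ}
    {h : ℕ → ℝ≥0∞} (hm : 1 ≤ h m) (hh : ∀ x, ∑' l, ENNReal.ofReal (p x l) * h l ≤ h x) :
    μ ({ω | X 0 ω = m} ∩ {ω | ∃ n ≥ 1, X n ω = m}) ≤
      μ {ω | X 0 ω = m} * ∑' l, ENNReal.ofReal (p m l) * h l := by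
  have h0 : {ω | X 0 ω = m} = {ω | ∀ k ≤ 0, X k ω = (fun _ => m : ℕ → ℕ) k} := by simp
  have hU : {ω | X 0 ω = m} ∩ {ω | ∃ n ≥ 1, X n ω = m} =
      ⋃ n, ({ω | X 0 ω = m} ∩ {ω | ∃ i ≤ n, X (0 + 1 + i) ω = m}) := by
    ext ω
    simp only [Set.mem_inter_iff, Set.mem_ofPred_eq, Set.mem_iUnion]
    constructor
    · rintro ⟨h1, n, hn, h2⟩
      exact ⟨n - 1, h1, n - 1, le_rfl, by rw [← h2]; congr 1; lia⟩
    · rintro ⟨n, h1, i, hi, h2⟩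
      exact ⟨h1, 0 + 1 + i, by lia, h2⟩
  have hmono : Monotone fun n => {ω | X 0 ω = m} ∩ {ω | ∃ i ≤ n, X (0 + 1 + i) ω = m} := by
    rintro a b hab ω ⟨h1, i, hi, h2⟩
    exact ⟨h1, i, hi.trans hab, h2⟩
  rw [hU, hmono.measure_iUnion]
  refine iSup_le fun n => ?_
  rw [h0, hX.measure_history_inter_eq_tsum 0 _ (hX.measurableSet_hit n (0 + 1) m),
    ← ENNReal.tsum_mul_left]
  refine ENNReal.tsum_le_tsum fun l => (hX.measure_history_inter_hit_le hm hh n _ _).trans_eq ?_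
  rw [hX.measure_history_succ, Function.update_self, mul_assoc]

/-- A chain with a finite Green function at `m` fails to return to `m` with positive probability. -/
lemma cond_return_lt_one [IsFiniteMeasure μ] (hX : IsMarkovChainWith p μ X) {m : ℕ}
    (hG : greenFun p m m ≠ ∞) (h0 : μ {ω | X 0 ω = m} ≠ 0) :
    μ[{ω | ∃ n ≥ 1, X n ω = m} | {ω | X 0 ω = m}] < 1 := by
  set g := greenFun p m m with hg
  have hgeq := greenFun_eq p m m
  rw [if_pos rfl, ← hg] at hgeq
  set s := ∑' l, ENNReal.ofReal (p m l) * greenFun p l m with hs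
  have hg0 : g ≠ 0 := by rw [hgeq]; simp
  -- Here g = 1 + s with s finite, so s / g < 1.
  have hsg : s < g := by
    have hs_top : s ≠ ∞ := fun h => hG (by rw [hgeq, h, add_top])
    rw [hgeq, add_comm]
    exact ENNReal.lt_add_right hs_top one_ne_zero
  have hsum : ∀ x, ∑' l, ENNReal.ofReal (p x l) * (greenFun p l m / g) =
      (∑' l, ENNReal.ofReal (p x l) * greenFun p l m) / g := fun x => by
    simp_rw [div_eq_mul_inv, ← mul_assoc]
    rw [ENNReal.tsum_mul_right]
  have hret := hX.measure_return_le (m := m) (h := fun x => greenFun p x m / g)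
    (ENNReal.div_self hg0 hG).ge fun x => by
      rw [hsum]
      gcongr
      rw [greenFun_eq p x m]
      exact le_add_self
  rw [hsum, ← hs] at hret
  rw [cond_apply (hX.measurableSet_eq 0 m)]
  calc _ ≤ (μ {ω | X 0 ω = m})⁻¹ * (μ {ω | X 0 ω = m} * (s / g)) := by gcongr
    _ = s / g := by
      rw [← mul_assoc, ENNReal.inv_mul_cancel h0 (measure_ne_top _ _), one_mul]
    _ < 1 := by
      rw [ENNReal.div_lt_iff (Or.inl hg0) (Or.inl hG), one_mul]
      exact hsg

end IsMarkovChainWith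

/-! ### Existence by the Ionescu-Tulcea construction. -/

/-- The kernels of a time-homogeneous Markov chain on `ℕ`, as functions of the whole history. -/
noncomputable def historyKernel (P : ℕ → PMF ℕ) (n : ℕ) :
    Kernel ((i : Finset.Iic n) → ℕ) ℕ :=
  Kernel.ofFunOfCountable fun h => (P (h ⟨n, Finset.mem_Iic.2 le_rfl⟩)).toMeasure

instance (P : ℕ → PMF ℕ) (n : ℕ) : IsMarkovKernel (historyKernel P n) :=
  ⟨fun _ => PMF.toMeasure.isProbabilityMeasure _⟩

lemma traj_historyKernel_apply (P : ℕ → PMF ℕ) (n : ℕ) (w a : (i : Finset.Iic n) → ℕ) (l : ℕ) :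
    Kernel.traj (X := fun _ => ℕ) (historyKernel P) n w
      ((Preorder.frestrictLe n) ⁻¹' {a} ∩ {x | x (n + 1) = l}) =
    Set.indicator {a} (fun _ => P (a ⟨n, Finset.mem_Iic.2 le_rfl⟩) l) w := by
  set ν := Kernel.traj (X := fun _ => ℕ) (historyKernel P) n w with hν
  have h1 : ∀ b, ν ((Preorder.frestrictLe n) ⁻¹' {b}) = Measure.dirac w {b} := by
    intro b
    have := Kernel.traj_map_frestrictLe_apply (X := fun _ => ℕ) (κ := historyKernel P) n n w
    rw [← Measure.map_apply (Preorder.measurable_frestrictLe n) (measurableSet_singleton b),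
      hν, this, Kernel.partialTraj_self, Kernel.id_apply]
  have h2 : ν {x | x (n + 1) = l} = P (w ⟨n, Finset.mem_Iic.2 le_rfl⟩) l := by
    have := congrArg (fun κ => κ w {l})
      (Kernel.map_traj_succ_self (X := fun _ => ℕ) (κ := historyKernel P) (a := n))
    rw [Kernel.map_apply' _ (by fun_prop) _ (measurableSet_singleton l)] at this
    refine this.trans ?_
    exact PMF.toMeasure_apply_singleton _ _ (measurableSet_singleton l)
  by_cases hw : w = a
  · subst hw
    -- The trajectory started from history w has prefix w almost surely, so that event can be
    -- dropped.
    rw [Set.indicator_of_mem (Set.mem_singleton w), ← h2, Set.inter_comm]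
    refine measure_inter_conull ?_
    rw [prob_compl_eq_zero_iff (Preorder.measurable_frestrictLe n (measurableSet_singleton w)), h1]
    simp
  · rw [Set.indicator_of_notMem (s := {a}) hw]
    refine measure_mono_null Set.inter_subset_left ?_
    rw [h1]
    simp [hw]

/-- Existence of the Markov chain with given transition probabilities and initial state. -/
lemma exists_isMarkovChainWith {p : ℕ → ℕ → ℝ} (hp : ∀ m l, 0 ≤ p m l)
    (hsum : ∀ m, HasSum (p m) 1) (m : ℕ) :
    ∃ P : Measure (ℕ → ℕ), IsProbabilityMeasure P ∧
      IsMarkovChainWith p P (fun n x => x n) ∧ P {x | x 0 = m} = 1 := by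
  let Q : ℕ → PMF ℕ := fun x => ⟨fun l => ENNReal.ofReal (p x l), by
    have h := ENNReal.summable (f := fun l => ENNReal.ofReal (p x l)) |>.hasSum
    rwa [← ENNReal.ofReal_tsum_of_nonneg (hp x) (hsum x).summable, (hsum x).tsum_eq,
      ENNReal.ofReal_one] at h⟩
  let x₀ : (i : Finset.Iic 0) → ℕ := fun _ => m
  let ν : Measure (ℕ → ℕ) := Kernel.traj (X := fun _ => ℕ) (historyKernel Q) 0 x₀
  have hprob : IsProbabilityMeasure ν := inferInstanceAs
    (IsProbabilityMeasure (Kernel.traj (X := fun _ => ℕ) (historyKernel Q) 0 x₀))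
  have hset : ∀ (n : ℕ) (a : ℕ → ℕ), {x : ℕ → ℕ | ∀ k ≤ n, x k = a k} =
      (Preorder.frestrictLe (π := fun _ => ℕ) n) ⁻¹' {Preorder.frestrictLe (π := fun _ => ℕ) n a} := by
    intro n a
    ext x
    simp only [Set.mem_ofPred_eq, Set.mem_preimage, Set.mem_singleton_iff, funext_iff,
      Subtype.forall, Finset.mem_Iic]
    rfl
  have hmeas : ∀ (n : ℕ) (b : (i : Finset.Iic n) → ℕ),
      MeasurableSet ((Preorder.frestrictLe (π := fun _ => ℕ) n) ⁻¹' {b}) := fun n b =>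
    Preorder.measurable_frestrictLe n (measurableSet_singleton b)
  have hmap : ∀ (n : ℕ) (b : (i : Finset.Iic n) → ℕ),
      ν ((Preorder.frestrictLe (π := fun _ => ℕ) n) ⁻¹' {b}) =
        Kernel.partialTraj (X := fun _ => ℕ) (historyKernel Q) 0 n x₀ {b} := fun n b => by
    rw [← Kernel.traj_map_frestrictLe_apply,
      Measure.map_apply (Preorder.measurable_frestrictLe n) (measurableSet_singleton b)]
  refine ⟨ν, hprob, ⟨fun n => measurable_pi_apply n, fun n a l h0 => ?_⟩, ?_⟩
  · rw [hset] at h0 ⊢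
    set b := Preorder.frestrictLe (π := fun _ => ℕ) n a with hb
    have key : ν ((Preorder.frestrictLe (π := fun _ => ℕ) n) ⁻¹' {b} ∩ {x | x (n + 1) = l}) =
        ν ((Preorder.frestrictLe (π := fun _ => ℕ) n) ⁻¹' {b}) * ENNReal.ofReal (p (a n) l) := by
      have hms : MeasurableSet {x : ℕ → ℕ | x (n + 1) = l} :=
        (measurable_pi_apply (n + 1) : Measurable fun x : ℕ → ℕ => x (n + 1))
          (measurableSet_singleton l)
      -- The law is split at time n: the prefix first, then its continuation.
      have hν : ν = (Kernel.traj (X := fun _ => ℕ) (historyKernel Q) n ∘ₖ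
          Kernel.partialTraj (X := fun _ => ℕ) (historyKernel Q) 0 n) x₀ := by
        rw [Kernel.traj_comp_partialTraj (Nat.zero_le n)]
      rw [hmap, hν, Kernel.comp_apply' _ _ _ ((hmeas n b).inter hms)]
      simp_rw [traj_historyKernel_apply]
      rw [lintegral_indicator_const (measurableSet_singleton b), mul_comm]
      rfl
    rw [cond_apply (hmeas n b), key, ← mul_assoc, ENNReal.inv_mul_cancel h0 (measure_ne_top _ _),
      one_mul]
  · have h := hset 0 (fun _ => m)
    simp only [nonpos_iff_eq_zero, forall_eq] at h
    rw [h, hmap, Kernel.partialTraj_self, Kernel.id_apply]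
    exact Measure.dirac_apply_of_mem rfl

theorem theorem2p3 (α : ℝ) (hα : 1 / 2 < α) (hα' : α < 1) :
    -- from every state the chain exists (here on the space of sequences)
    (∀ m : ℕ, ∃ P : Measure (ℕ → ℕ), IsProbabilityMeasure P ∧
      IsMarkovChainWith (transitionProb α) P (fun n x => x n) ∧ P {x | x 0 = m} = 1) ∧
    -- every realization, with any initial law, is transient and escapes to infinity
    (∀ {Ω : Type*} [MeasurableSpace Ω] (μ : Measure Ω) [IsProbabilityMeasure μ] (X : ℕ → Ω → ℕ),
      IsMarkovChainWith (transitionProb α) μ X →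
        (∀ m : ℕ, μ {ω | X 0 ω = m} ≠ 0 →
          μ[{ω | ∃ n ≥ 1, X n ω = m} | {ω | X 0 ω = m}] < 1) ∧
        ∀ᵐ ω ∂μ, Tendsto (fun n => X n ω) atTop atTop) := by
  refine ⟨fun m => exists_isMarkovChainWith (transitionProb_nonneg hα) (hasSum_transitionProb hα) m,
    fun {Ω} _ μ _ X hX => ?_⟩
  obtain ⟨K, hK, hG⟩ := exists_greenFun_le hα hα'
  exact ⟨fun m hm => hX.cond_return_lt_one (ne_top_of_le_ne_top hK (hG m m)) hm,
    hX.tendsto_atTop hK hG⟩
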